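/- **Theorem 5.2.** Let $t_1,t_2,h_1,h_2,l_1,l_2,\alpha_1,\alpha_2,\beta$ be real numbers, put $$\lambda_1=\frac{h_1+h_2-l_1-l_2-\alpha_1-\alpha_2-\beta+2}{2},$$ and assume that $N:=-\lambda_1-\alpha_1$ is a non-negative integer, $\beta<1$, $\alpha_2-\alpha_1<1$, $t_1>0$, $t_2>0$, $h_1<h_2$, $l_1<l_2$, $1+h_2-l_2-\beta>0$ and $2+2h_2-l_1-l_2-\beta>0$. For $0<q<1$ let the polynomials $c_n(E)$ be determined by $c_{-1}=0$, $c_0=1$ and, for $n\ge 1$, $$t_1t_2\,q^{h_1+h_2}(1-q^n)(1-q^{n-\beta})\,c_n(E)=\Big[Eq^{n-1+\lambda_1}+q^{1/2}(q^{h_1}t_1+q^{h_2}t_2)+(q^{l_1}t_1+q^{l_2}t_2)q^{2(n+\lambda_1)+\alpha_1+\alpha_2-5/2}\Big]c_{n-1}(E)-q(1-q^{n-2+\lambda_1+\alpha_1})(1-q^{n-2+\lambda_1+\alpha_2})\,c_{n-2}(E).$$ Let $k\in\{1,\dots,N+1\}$. Then there is $q_0\in(0,1)$ such that for $0<q<q_0$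 the polynomial $c_{N+1}(E)$ has degree $N+1$ and $N+1$ distinct real roots $E_1(q)<E_2(q)<\dots<E_{N+1}(q)$, and there are real functions $x_1,\dots,x_N$, continuous on $(0,q_0)$, such that for each $q\in(0,q_0)$ the numbers $x_1(q),\dots,x_N(q)$ are zeros of the Heun polynomial $\sum_{n=0}^{N}c_n(E_{N+2-k}(q))\,x^n$, and $$\lim_{q\to+0}\frac{x_j(q)}{q^{\,j-1/2+h_2}\,t_2}=1\quad(j=1,\dots,k-1),\qquad \lim_{q\to+0}\frac{x_j(q)}{-q^{-2j-1/2-h_2+l_1+l_2+\beta}\,t_1}=1\quad(j=k,\dots,N).$$ -/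

import Mathlib

open Filter Topology Set

/-- The (real) parameters of the `q`-Heun equation. -/
structure QHeunParams where
  t₁ : ℝ
  t₂ : ℝ
  h₁ : ℝ
  h₂ : ℝ
  l₁ : ℝ
  l₂ : ℝ
  α₁ : ℝ
  α₂ : ℝ
  β : ℝ

namespace QHeunParams

/-- The exponent `λ₁ = (h₁ + h₂ - l₁ - l₂ - α₁ - α₂ - β + 2) / 2` at the origin. -/
noncomputable def lam (P : QHeunParams) : ℝ :=
  (P.h₁ + P.h₂ - P.l₁ - P.l₂ - P.α₁ - P.α₂ - P.β + 2) / 2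

/-- The factor `t₁ t₂ q^{h₁+h₂} (1 - q^n) (1 - q^{n-β})` of `c_n` in the three term relation. -/
noncomputable def recLead (P : QHeunParams) (q : ℝ) (n : ℕ) : ℝ :=
  P.t₁ * P.t₂ * (q ^ (P.h₁ + P.h₂) * (1 - q ^ (n : ℝ)) * (1 - q ^ ((n : ℝ) - P.β)))

/-- The factor of `c_{n-1}` in the three term relation, a polynomial in the indeterminate `E`:
`E q^{n-1+λ₁} + q^{1/2} (q^{h₁} t₁ + q^{h₂} t₂)
  + (q^{l₁} t₁ + q^{l₂} t₂) q^{2(n+λ₁)+α₁+α₂-5/2}`. -/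
noncomputable def recMid (P : QHeunParams) (q : ℝ) (n : ℕ) : Polynomial ℝ :=
  Polynomial.C (q ^ ((n : ℝ) - 1 + P.lam)) * Polynomial.X
    + Polynomial.C (q ^ (1 / 2 : ℝ) * (q ^ P.h₁ * P.t₁ + q ^ P.h₂ * P.t₂)
      + (q ^ P.l₁ * P.t₁ + q ^ P.l₂ * P.t₂)
        * q ^ (2 * ((n : ℝ) + P.lam) + P.α₁ + P.α₂ - 5 / 2))

/-- The factor `q (1 - q^{n-2+λ₁+α₁}) (1 - q^{n-2+λ₁+α₂})` of `-c_{n-2}` in the three term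
relation. -/
noncomputable def recTail (P : QHeunParams) (q : ℝ) (n : ℕ) : ℝ :=
  q * (1 - q ^ ((n : ℝ) - 2 + P.lam + P.α₁)) * (1 - q ^ ((n : ℝ) - 2 + P.lam + P.α₂))

/-- The polynomials `c_n(E)`, determined by `c_{-1} = 0`, `c_0 = 1` and
`recLead n * c_n = recMid n * c_{n-1} - recTail n * c_{n-2}` for `n ≥ 1`. -/
noncomputable def coeffPoly (P : QHeunParams) (q : ℝ) : ℕ → Polynomial ℝ
  | 0 => 1
  | 1 => Polynomial.C (P.recLead q 1)⁻¹ * P.recMid q 1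
  | n + 2 => Polynomial.C (P.recLead q (n + 2))⁻¹ *
      (P.recMid q (n + 2) * coeffPoly P q (n + 1)
        - Polynomial.C (P.recTail q (n + 2)) * coeffPoly P q n)

/-- `E_j(q)`: the `j`-th smallest (`j = 1, …, N + 1`) real root of the spectral polynomial
`c_{N+1}(E)`.  The default value `0` is only used when there are fewer than `j` real roots. -/
noncomputable def spectralRoot (P : QHeunParams) (N : ℕ) (j : ℕ) (q : ℝ) : ℝ :=
  ((P.coeffPoly q (N + 1)).roots.sort (· ≤ ·)).getD (j - 1) 0

/-- The Heun polynomial `∑_{n=0}^N c_n(E) x^n` as a polynomial in `x`, for a value `E`. -/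
noncomputable def heunPoly (P : QHeunParams) (N : ℕ) (q E : ℝ) : Polynomial ℝ :=
  ∑ n ∈ Finset.range (N + 1), Polynomial.C ((P.coeffPoly q n).eval E) * Polynomial.X ^ n

end QHeunParams

/-! The argument is a Newton polygon computation as `q → 0+`, carried out twice. If the successive
coefficient ratios of a real polynomial behave like `C m * q ^ e m` with `C m ≠ 0` and `e` strictly
increasing, then near `x = -a n / a (n + 1)` only the terms `n` and `n + 1` matter. After rescaling,
the polynomial tends to `z ^ n - z ^ (n + 1)`, whose simple root `1` persists by the implicit
function theorem (`exists_root_branch`).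

Applied in `E` to `c_{N+1}`, whose coefficient orders are strictly convex in `m` (`coeff`), this
gives all `N + 1` roots, of sizes `-t₁ q^{-(i + λ₁ - 1/2 - h₁)}`, `i = 0, …, N`, decreasing in `i`.

Fix the root with `i = k - 1`. In the middle factor of the recurrence the `E` term dominates for `n
< i` and the constant term for `n > i`; at `n = i` the leading terms cancel. The ratios
`c_{n+1}/c_n` are therefore found by forward recursion for `n < i` (`ratio_of_lt`), and for `n ≥ i`
by backward recursion from `c_{N+1}(E) = 0` (`ratio_of_ge`), which never uses the index `i`. Their
orders again increase strictly, so `exists_root_branch` applies in `x`. -/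

/-- The coefficient vector of the polynomial `z ^ n - z ^ (n + 1)`. -/
noncomputable def binomialCoeffs (n m : ℕ) : ℝ := if m = n then 1 else if m = n + 1 then -1 else 0

lemma sum_binomialCoeffs {N n : ℕ} (h : n < N) (g : ℕ → ℝ) :
    ∑ m : Fin (N + 1), binomialCoeffs n m * g m = g n - g (n + 1) := by
  rw [Fin.sum_univ_eq_sum_range (fun m => binomialCoeffs n m * g m)]
  have : ∀ m, binomialCoeffs n m * g m
      = (if m = n then g m else 0) - (if m = n + 1 then g m else 0) := by
    intro m
    unfold binomialCoeffs
    by_cases h1 : m = n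
    · simp [h1]
    · by_cases h2 : m = n + 1 <;> simp [h1, h2]
  simp only [this, Finset.sum_sub_distrib, Finset.sum_ite_eq', Finset.mem_range]
  rw [if_pos (by omega), if_pos (by omega)]

/-- Near the coefficients of `z ^ n - z ^ (n + 1)`, the root `1` extends to a continuous root. -/
lemma exists_continuous_root_near_one {N n : ℕ} (h : n < N) :
    ∃ ζ : (Fin (N + 1) → ℝ) → ℝ,
      Tendsto ζ (𝓝 fun m => binomialCoeffs n m) (𝓝 1) ∧
      ∀ᶠ d in 𝓝 (fun m : Fin (N + 1) => binomialCoeffs n m),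
        ContinuousAt ζ d ∧ ∑ m : Fin (N + 1), d m * ζ d ^ (m : ℕ) = 0 := by
  set d₀ : Fin (N + 1) → ℝ := fun m => binomialCoeffs n m with hd₀
  let f : (Fin (N + 1) → ℝ) × ℝ → ℝ := fun v => ∑ m : Fin (N + 1), v.1 m * v.2 ^ (m : ℕ)
  have hf : ContDiff ℝ 1 f := by fun_prop
  have hfat : ContDiffAt ℝ 1 f (d₀, 1) := hf.contDiffAt
  have hval : ∀ z, f (d₀, z) = z ^ n - z ^ (n + 1) := fun z =>
    sum_binomialCoeffs h (fun m => z ^ m)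
  -- The derivative in `z` at `1` is `n - (n + 1) = -1`, so the root is simple.
  have hder : fderiv ℝ f (d₀, 1) ∘L .inr ℝ (Fin (N + 1) → ℝ) ℝ =
      ((ContinuousLinearEquiv.neg ℝ : ℝ ≃L[ℝ] ℝ) : ℝ →L[ℝ] ℝ) := by
    have h1 : HasFDerivAt f (fderiv ℝ f (d₀, 1)) (d₀, 1) :=
      (hf.differentiable (by norm_num)).differentiableAt.hasFDerivAt
    have h2 : HasFDerivAt (fun z : ℝ => (d₀, z)) (.inr ℝ (Fin (N + 1) → ℝ) ℝ) (1 : ℝ) :=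
      hasFDerivAt_prodMk_right d₀ (1 : ℝ)
    have h3 := (HasFDerivAt.comp (1 : ℝ) h1 h2).hasDerivAt
    have h4 : HasDerivAt (fun z : ℝ => z ^ n - z ^ (n + 1)) (n * 1 ^ (n - 1) -
        ((n + 1 : ℕ) : ℝ) * 1 ^ (n + 1 - 1)) 1 :=
      (hasDerivAt_pow n 1).sub (hasDerivAt_pow (n + 1) 1)
    have h5 : (f ∘ fun z : ℝ => (d₀, z)) = fun z : ℝ => z ^ n - z ^ (n + 1) := funext hval
    rw [h5] at h3
    have h6 := h3.unique h4
    ext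
    rw [h6]
    simp
  have hinv : (fderiv ℝ f (d₀, 1) ∘L .inr ℝ (Fin (N + 1) → ℝ) ℝ).IsInvertible := ⟨_, hder.symm⟩
  have hcd := hfat.contDiffAt_implicitFunction one_ne_zero hinv
  refine ⟨hfat.implicitFunction one_ne_zero hinv, ?_, ?_⟩
  · have := hcd.continuousAt.tendsto
    rwa [hfat.implicitFunction_apply_self] at this
  · filter_upwards [hcd.eventually (by simp),
      hfat.eventually_apply_implicitFunction one_ne_zero hinv] with d hd hd'
    refine ⟨hd.continuousAt, ?_⟩
    rw [hval] at hd'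
    simpa using hd'

/-! ### Calculus of power asymptotics at `0+` -/

lemma eventually_mem_Ioo_nhdsGT_zero : ∀ᶠ q : ℝ in 𝓝[>] 0, q ∈ Ioo (0 : ℝ) 1 :=
  Ioo_mem_nhdsGT one_pos

lemma tendsto_rpow_nhdsGT_zero {e : ℝ} (he : 0 < e) :
    Tendsto (fun q : ℝ => q ^ e) (𝓝[>] 0) (𝓝 0) := by
  have := (Real.continuousAt_rpow_const 0 e (Or.inr he.le)).tendsto
  rw [Real.zero_rpow he.ne'] at this
  exact this.mono_left nhdsWithin_le_nhds

/-- `f` behaves like `C * q ^ e` as `q → 0+`. -/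
def PowerLike (f : ℝ → ℝ) (e C : ℝ) : Prop :=
  Tendsto (fun q => f q * q ^ (-e)) (𝓝[>] 0) (𝓝 C)

namespace PowerLike

variable {f g : ℝ → ℝ} {e e' C C' : ℝ}

lemma congr (h : PowerLike f e C) (hfg : ∀ᶠ q in 𝓝[>] 0, f q = g q) : PowerLike g e C := by
  refine Tendsto.congr' ?_ h
  filter_upwards [hfg] with q hq
  rw [hq]

lemma congr_exp (h : PowerLike f e C) (he : e = e') (hC : C = C') : PowerLike f e' C' := by
  subst he hC; exact h

lemma mul (hf : PowerLike f e C) (hg : PowerLike g e' C') :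
    PowerLike (fun q => f q * g q) (e + e') (C * C') := by
  refine Tendsto.congr' ?_ (Tendsto.mul hf hg)
  filter_upwards [eventually_mem_Ioo_nhdsGT_zero] with q hq
  rw [neg_add, Real.rpow_add hq.1]
  ring

lemma inv (hf : PowerLike f e C) (hC : C ≠ 0) : PowerLike (fun q => (f q)⁻¹) (-e) C⁻¹ := by
  refine Tendsto.congr' ?_ (Tendsto.inv₀ hf hC)
  filter_upwards [eventually_mem_Ioo_nhdsGT_zero] with q hq
  rw [mul_inv, Real.rpow_neg hq.1.le (-e)]

lemma div (hf : PowerLike f e C) (hg : PowerLike g e' C') (hC : C' ≠ 0) :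
    PowerLike (fun q => f q / g q) (e - e') (C / C') := by
  simpa only [div_eq_mul_inv, sub_eq_add_neg] using hf.mul (hg.inv hC)

lemma add (hf : PowerLike f e C) (hg : PowerLike g e C') :
    PowerLike (fun q => f q + g q) e (C + C') := by
  simpa only [PowerLike, add_mul] using Tendsto.add hf hg

lemma neg (hf : PowerLike f e C) : PowerLike (fun q => -f q) e (-C) := by
  simpa only [PowerLike, neg_mul] using Tendsto.neg hf

lemma sub (hf : PowerLike f e C) (hg : PowerLike g e C') :
    PowerLike (fun q => f q - g q) e (C - C') := by
  simpa only [sub_eq_add_neg] using hf.add hg.neg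

lemma rpow (e : ℝ) : PowerLike (fun q => q ^ e) e 1 := by
  refine Tendsto.congr' ?_ tendsto_const_nhds
  filter_upwards [eventually_mem_Ioo_nhdsGT_zero] with q hq
  rw [← Real.rpow_add hq.1, add_neg_cancel, Real.rpow_zero]

lemma const (c : ℝ) : PowerLike (fun _ => c) 0 c := by
  simp [PowerLike]

/-- `PowerLike` with constant `0` means `o(q ^ e)`; this is how dominated terms are discarded. -/
lemma weaken (hf : PowerLike f e C) (he : e' < e) : PowerLike f e' 0 := by
  have := Tendsto.mul hf (tendsto_rpow_nhdsGT_zero (sub_pos.2 he))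
  rw [mul_zero] at this
  refine Tendsto.congr' ?_ this
  filter_upwards [eventually_mem_Ioo_nhdsGT_zero] with q hq
  rw [mul_assoc, ← Real.rpow_add hq.1]
  congr 2
  ring

lemma tendsto (hf : PowerLike f 0 C) : Tendsto f (𝓝[>] 0) (𝓝 C) := by
  simpa [PowerLike] using hf

lemma eventually_ne_zero (hf : PowerLike f e C) (hC : C ≠ 0) : ∀ᶠ q in 𝓝[>] 0, f q ≠ 0 := by
  filter_upwards [Tendsto.eventually_ne hf hC] with q hq h0
  simp [h0] at hq

lemma eventually_lt (hf : PowerLike f e C) (hg : PowerLike g e C') (hC : C < C') :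
    ∀ᶠ q in 𝓝[>] 0, f q < g q := by
  filter_upwards [Tendsto.eventually_lt hf hg hC, eventually_mem_Ioo_nhdsGT_zero] with q hq hq'
  exact lt_of_mul_lt_mul_right hq (Real.rpow_nonneg hq'.1.le _)

end PowerLike

/-! ### Newton polygon with simple slopes -/

/-- If consecutive ratios of the coefficients of a polynomial have strictly increasing orders, then
each of these ratios gives rise to a continuous branch of real roots. -/
lemma exists_root_branch {N n : ℕ} (hn : n < N) (a : ℕ → ℝ → ℝ) (e C : ℕ → ℝ)
    (hcont : ∀ m ≤ N, ∀ᶠ q in 𝓝[>] 0, ContinuousAt (a m) q)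
    (hC : ∀ m < N, C m ≠ 0) (he : ∀ m, m + 1 < N → e m < e (m + 1))
    (ha : ∀ m < N, PowerLike (fun q => a (m + 1) q / a m q) (e m) (C m)) :
    ∃ x : ℝ → ℝ, (∀ᶠ q in 𝓝[>] 0, ContinuousAt x q) ∧
      (∀ᶠ q in 𝓝[>] 0, ∑ m ∈ Finset.range (N + 1), a m q * x q ^ m = 0) ∧
      PowerLike x (-e n) (-(C n)⁻¹) := by
  have hne : ∀ m ≤ N, ∀ᶠ q in 𝓝[>] 0, a m q ≠ 0 := by
    intro m hm
    rcases hm.lt_or_eq with hm | rfl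
    · filter_upwards [(ha m hm).eventually_ne_zero (hC m hm)] with q hq h0
      simp [h0] at hq
    · obtain ⟨m, rfl⟩ : ∃ p, m = p + 1 := ⟨m - 1, by omega⟩
      filter_upwards [(ha m (by omega)).eventually_ne_zero (hC m (by omega))] with q hq h0
      simp [h0] at hq
  -- The tentative root, which balances the terms of degrees `n` and `n + 1`.
  let ξ : ℝ → ℝ := fun q => -(a n q / a (n + 1) q)
  have hξ : PowerLike ξ (-e n) (-(C n)⁻¹) := by
    refine ((ha n hn).inv (hC n hn)).neg.congr ?_
    exact Eventually.of_forall fun q => by simp [ξ]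
  have hξ0 : ∀ᶠ q in 𝓝[>] 0, ξ q ≠ 0 := hξ.eventually_ne_zero (by simp [hC n hn])
  -- Coefficients after substituting `x = ξ z`, normalised so that `d n = 1`.
  let d : ℕ → ℝ → ℝ := fun m q => a m q * ξ q ^ m / (a n q * ξ q ^ n)
  have hemono : ∀ m p, m < p → p < N → e m < e p := by
    intro m p hmp
    induction p, hmp using Nat.le_induction with
    | base => exact he m
    | succ p hp ih => exact fun h => (ih (by omega)).trans (he p h)
  have hstep : ∀ m < N, PowerLike (fun q => d (m + 1) q / d m q) (e m - e n)
      (-(C m * (C n)⁻¹)) := by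
    intro m hm
    have := (ha m hm).mul hξ
    refine (this.congr ?_).congr_exp (by ring) (by ring)
    filter_upwards [hξ0, hne n hn.le, hne m hm.le] with q h1 h2 h3
    simp only [d]
    field_simp
    ring
  have hdn : ∀ᶠ q in 𝓝[>] 0, d n q = 1 := by
    filter_upwards [hξ0, hne n hn.le] with q h1 h2
    simp only [d]
    field_simp
  have hdne : ∀ m ≤ N, ∀ᶠ q in 𝓝[>] 0, d m q ≠ 0 := by
    intro m hm
    filter_upwards [hξ0, hne n hn.le, hne m hm] with q h1 h2 h3
    simp only [d]
    positivity
  -- The ratio `d (m + 1) / d m` has order `e m - e n`, positive for `m > n` and negative for `m <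
  -- n`; hence coefficients vanish in the limit when moving away from `n`, `n + 1` on either side.
  have hup : ∀ m, n + 1 ≤ m → m ≤ N → Tendsto (d m) (𝓝[>] 0) (𝓝 (binomialCoeffs n m)) := by
    intro m hm
    induction m, hm using Nat.le_induction with
    | base =>
      intro _
      have h1 := hstep n hn
      rw [sub_self, mul_inv_cancel₀ (hC n hn)] at h1
      have h2 : binomialCoeffs n (n + 1) = -1 := by simp [binomialCoeffs]
      rw [h2]
      refine Tendsto.congr' ?_ h1.tendsto
      filter_upwards [hdn] with q h
      simp [h]
    | succ m hm ih =>
      intro hmN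
      have h1 := ((hstep m (by omega)).weaken
        (sub_pos.2 (hemono n m (by omega) (by omega)))).tendsto
      have h2 := h1.mul (ih (by omega))
      rw [zero_mul] at h2
      have h3 : binomialCoeffs n (m + 1) = 0 := by
        unfold binomialCoeffs
        rw [if_neg (by omega), if_neg (by omega)]
      rw [h3]
      refine Tendsto.congr' ?_ h2
      filter_upwards [hdne m (by omega)] with q h
      field_simp
  have hdown : ∀ i, ∀ m, m + i = n → Tendsto (d m) (𝓝[>] 0) (𝓝 (binomialCoeffs n m)) := by
    intro i
    induction i with
    | zero =>
      rintro m rfl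
      have h2 : binomialCoeffs m m = 1 := by simp [binomialCoeffs]
      rw [add_zero, h2]
      exact tendsto_const_nhds.congr' (by filter_upwards [hdn] with q h using h.symm)
    | succ i ih =>
      intro m hm
      have h0 : -(C m * (C n)⁻¹) ≠ 0 := by simp [hC n hn, hC m (by omega)]
      have h1 := (((hstep m (by omega)).inv h0).weaken (e' := 0)
        (by have := hemono m n (by omega) hn; linarith)).tendsto
      have h2 := h1.mul (ih (m + 1) (by omega))
      rw [zero_mul] at h2
      have h3 : binomialCoeffs n m = 0 := by
        unfold binomialCoeffs
        rw [if_neg (by omega), if_neg (by omega)]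
      rw [h3]
      refine Tendsto.congr' ?_ h2
      filter_upwards [hdne m (by omega), hdne (m + 1) (by omega)] with q h h'
      field_simp
  have hd : ∀ m ≤ N, Tendsto (d m) (𝓝[>] 0) (𝓝 (binomialCoeffs n m)) := by
    intro m hm
    rcases le_or_gt m n with h | h
    · exact hdown (n - m) m (by omega)
    · exact hup m h hm
  have hξc : ∀ᶠ q in 𝓝[>] 0, ContinuousAt ξ q := by
    filter_upwards [hcont n hn.le, hcont (n + 1) hn, hne (n + 1) hn] with q h1 h2 h3
    exact (h1.div h2 h3).neg
  have hdc : ∀ m ≤ N, ∀ᶠ q in 𝓝[>] 0, ContinuousAt (d m) q := by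
    intro m hm
    filter_upwards [hcont n hn.le, hcont m hm, hξc, hne n hn.le, hξ0] with q h1 h2 h3 h4 h5
    exact (h2.mul (h3.pow m)).div (h1.mul (h3.pow n)) (by positivity)
  obtain ⟨ζ, hζ1, hζ⟩ := exists_continuous_root_near_one hn
  let D : ℝ → Fin (N + 1) → ℝ := fun q m => d m q
  have hD : Tendsto D (𝓝[>] 0) (𝓝 fun m => binomialCoeffs n m) :=
    tendsto_pi_nhds.2 fun m => hd m (by omega)
  have hDc : ∀ᶠ q in 𝓝[>] 0, ContinuousAt D q := by
    have : ∀ᶠ q in 𝓝[>] 0, ∀ m : Fin (N + 1), ContinuousAt (d m) q :=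
      eventually_all.2 fun m => hdc m (by omega)
    filter_upwards [this] with q h
    exact continuousAt_pi.2 h
  refine ⟨fun q => ζ (D q) * ξ q, ?_, ?_, ?_⟩
  · filter_upwards [hD.eventually hζ, hDc, hξc] with q h1 h2 h3
    exact (ContinuousAt.comp (f := D) h1.1 h2).mul h3
  · filter_upwards [hD.eventually hζ, hξ0, hne n hn.le] with q h1 h2 h3
    have h4 := h1.2
    simp only [D] at h4
    rw [Fin.sum_univ_eq_sum_range (fun m => d m q * ζ (D q) ^ m)] at h4
    have h5 := congrArg (fun t => a n q * ξ q ^ n * t) h4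
    simp only [mul_zero, Finset.mul_sum] at h5
    rw [← h5]
    refine Finset.sum_congr rfl fun m _ => ?_
    rw [mul_pow]
    simp only [d]
    field_simp
  · have h1 : PowerLike (fun q => ζ (D q)) 0 1 := by
      simpa [PowerLike, Function.comp_def] using hζ1.comp hD
    exact (h1.mul hξ).congr_exp (by ring) (by ring)

lemma PowerLike.zero (e : ℝ) : PowerLike (fun _ => 0) e 0 := by
  simp [PowerLike]

lemma PowerLike.one_sub_rpow_of_pos {e : ℝ} (he : 0 < e) :
    PowerLike (fun q => 1 - q ^ e) 0 1 :=
  ((PowerLike.const 1).sub ((PowerLike.rpow e).weaken he)).congr_exp rfl (sub_zero 1)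

lemma PowerLike.one_sub_rpow_of_neg {e : ℝ} (he : e < 0) :
    PowerLike (fun q => 1 - q ^ e) e (-1) :=
  (((PowerLike.const 1).weaken he).sub (PowerLike.rpow e)).congr_exp rfl (zero_sub 1)

/-! ### Asymptotics of the recurrence and of the coefficients of `c_n(E)` -/

namespace QHeunParams

/-- The assumptions on the parameters under which the spectral polynomial `c_{N+1}` and the Heun
polynomials have well separated roots as `q → 0+`. -/
structure Admissible (P : QHeunParams) (N : ℕ) : Prop where
  degree_eq : (N : ℝ) = -P.lam - P.α₁
  beta_lt : P.β < 1
  alpha_sub_lt : P.α₂ - P.α₁ < 1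
  t₁_pos : 0 < P.t₁
  t₂_pos : 0 < P.t₂
  h_lt : P.h₁ < P.h₂
  l_lt : P.l₁ < P.l₂
  mid_pos : 0 < 1 + P.h₂ - P.l₂ - P.β
  gap_pos : 0 < 2 + 2 * P.h₂ - P.l₁ - P.l₂ - P.β

/-- The constant coefficient of `recMid`. -/
noncomputable def midConst (P : QHeunParams) (q : ℝ) (n : ℕ) : ℝ :=
  q ^ (1 / 2 : ℝ) * (q ^ P.h₁ * P.t₁ + q ^ P.h₂ * P.t₂)
      + (q ^ P.l₁ * P.t₁ + q ^ P.l₂ * P.t₂)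
        * q ^ (2 * ((n : ℝ) + P.lam) + P.α₁ + P.α₂ - 5 / 2)

lemma recMid_eq (P : QHeunParams) (q : ℝ) (n : ℕ) :
    P.recMid q n = Polynomial.C (q ^ ((n : ℝ) - 1 + P.lam)) * Polynomial.X
      + Polynomial.C (P.midConst q n) := rfl

/-- The predecessor `c_{n-1}` of `c_n`, with `c_{-1} = 0`. -/
noncomputable def prevPoly (P : QHeunParams) (q : ℝ) : ℕ → Polynomial ℝ
  | 0 => 0
  | n + 1 => P.coeffPoly q n

lemma coeffPoly_succ (P : QHeunParams) (q : ℝ) (n : ℕ) :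
    P.coeffPoly q (n + 1) = Polynomial.C (P.recLead q (n + 1))⁻¹ *
      (P.recMid q (n + 1) * P.coeffPoly q n
        - Polynomial.C (P.recTail q (n + 1)) * P.prevPoly q n) := by
  cases n with
  | zero => simp [coeffPoly, prevPoly]
  | succ n => rfl

lemma natDegree_coeffPoly_le (P : QHeunParams) (q : ℝ) (n : ℕ) :
    (P.coeffPoly q n).natDegree ≤ n := by
  induction n using Nat.strong_induction_on with
  | _ n ih =>
    cases n with
    | zero => simp [coeffPoly]
    | succ n =>
      rw [coeffPoly_succ]
      refine (Polynomial.natDegree_C_mul_le _ _).trans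
        ((Polynomial.natDegree_sub_le _ _).trans (max_le ?_ ?_))
      · have h1 : (P.recMid q (n + 1)).natDegree ≤ 1 := by
          rw [recMid_eq]; exact Polynomial.natDegree_linear_le
        have := Polynomial.natDegree_mul_le (p := P.recMid q (n + 1)) (q := P.coeffPoly q n)
        have := ih n (by omega)
        omega
      · refine (Polynomial.natDegree_C_mul_le _ _).trans ?_
        cases n with
        | zero => simp [prevPoly]
        | succ n => exact (ih n (by omega)).trans (by omega)

variable {P : QHeunParams} {N : ℕ}

namespace Admissible

lemma recLead (hP : P.Admissible N) (n : ℕ) :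
    PowerLike (fun q => P.recLead q (n + 1)) (P.h₁ + P.h₂) (P.t₁ * P.t₂) := by
  have h1 : PowerLike (fun q : ℝ => 1 - q ^ ((n + 1 : ℕ) : ℝ)) 0 1 :=
    PowerLike.one_sub_rpow_of_pos (by positivity)
  have h2 : PowerLike (fun q : ℝ => 1 - q ^ (((n + 1 : ℕ) : ℝ) - P.β)) 0 1 :=
    PowerLike.one_sub_rpow_of_pos (by
      have := hP.beta_lt
      have : (0 : ℝ) ≤ n := n.cast_nonneg
      push_cast; linarith)
  exact ((PowerLike.const (P.t₁ * P.t₂)).mul (((PowerLike.rpow _).mul h1).mul h2)).congr_exp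
    (by ring) (by ring)

/-- The exponents in the two brackets are `n - 1 - N` and `n - 1 - N + (α₂ - α₁)`. Both are
negative, so each bracket behaves like minus its power of `q`. -/
lemma recTail (hP : P.Admissible N) {n : ℕ} (hn : n ≤ N) :
    PowerLike (fun q => P.recTail q (n + 1))
      (2 * n + 1 + (P.h₁ + P.h₂ - P.l₁ - P.l₂ - P.β)) 1 := by
  have hn' : (n : ℝ) ≤ N := by exact_mod_cast hn
  have h0 := hP.degree_eq
  have h0' := hP.alpha_sub_lt
  have h1 : PowerLike (fun q : ℝ => 1 - q ^ (((n + 1 : ℕ) : ℝ) - 2 + P.lam + P.α₁)) _ (-1) :=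
    PowerLike.one_sub_rpow_of_neg (by push_cast; linarith)
  have h2 : PowerLike (fun q : ℝ => 1 - q ^ (((n + 1 : ℕ) : ℝ) - 2 + P.lam + P.α₂)) _ (-1) :=
    PowerLike.one_sub_rpow_of_neg (by push_cast; linarith)
  have h3 : PowerLike (fun q : ℝ => q) 1 1 := by simpa using PowerLike.rpow 1
  refine ((h3.mul h1).mul h2).congr_exp ?_ (by ring)
  unfold lam
  push_cast
  ring

/-- `h_lt` and `l_lt` select the `t₁` terms, and `mid_pos` makes the `h₁` term dominate the `l₁`
term. -/
lemma midConst (hP : P.Admissible N) (n : ℕ) :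
    PowerLike (fun q => P.midConst q (n + 1)) (1 / 2 + P.h₁) P.t₁ := by
  have h0 := hP.h_lt
  have h1 := hP.l_lt
  have h2 := hP.mid_pos
  have hn : (0 : ℝ) ≤ n := n.cast_nonneg
  have a1 := (PowerLike.rpow (1 / 2)).mul (((PowerLike.rpow P.h₁).mul (PowerLike.const P.t₁)).add
    (((PowerLike.rpow P.h₂).mul (PowerLike.const P.t₂)).weaken
      (e' := P.h₁ + 0) (by linarith)))
  have a2 := ((((PowerLike.rpow P.l₁).mul (PowerLike.const P.t₁)).add
    (((PowerLike.rpow P.l₂).mul (PowerLike.const P.t₂)).weaken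
      (e' := P.l₁ + 0) (by linarith))).mul
    (PowerLike.rpow (2 * (((n + 1 : ℕ) : ℝ) + P.lam) + P.α₁ + P.α₂ - 5 / 2))).weaken
      (e' := 1 / 2 + (P.h₁ + 0)) (by unfold lam; push_cast; linarith)
  exact (a1.add a2).congr_exp (by ring) (by ring)

/-- The order of the coefficient of `E ^ m` in `c_n(E)` as `q → 0+`. -/
noncomputable def _root_.QHeunParams.coeffOrder (P : QHeunParams) (n m : ℕ) : ℝ :=
  m * (m + 1) / 2 - m * (3 / 2 + P.h₁ - P.lam) - n * (P.h₂ - 1 / 2)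

/-- The `c_{n-2}` term is negligible by `gap_pos`, so `c_n` behaves like the product of `recMid /
recLead` over the indices `1, …, n`. In the coefficient of `E ^ m` the lowest power of `q` comes
from taking `E` in the first `m` factors. -/
lemma coeff (hP : P.Admissible N) {n m : ℕ} (hn : n ≤ N + 1) (hm : m ≤ n) :
    PowerLike (fun q => (P.coeffPoly q n).coeff m) (P.coeffOrder n m)
      (P.t₂⁻¹ ^ n * P.t₁⁻¹ ^ m) := by
  induction n using Nat.strong_induction_on generalizing m with
  | _ n ih =>
  cases n with
  | zero =>
    obtain rfl : m = 0 := by omega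
    simpa [coeffPoly, coeffOrder] using PowerLike.const 1
  | succ n =>
  have ht₁ := hP.t₁_pos.ne'
  have ht₂ := hP.t₂_pos.ne'
  have hgap := hP.gap_pos
  -- The order expected of `recLead * c_{n+1}`, against which each term of the recurrence is
  -- compared.
  set η := P.h₁ + P.h₂ + P.coeffOrder (n + 1) m with hη
  have hprev : PowerLike (fun q => P.recTail q (n + 1) * (P.prevPoly q n).coeff m) η 0 := by
    cases n with
    | zero => simpa [prevPoly] using PowerLike.zero η
    | succ n =>
      by_cases hmn : m ≤ n
      · refine ((hP.recTail (n := n + 1) (by omega)).mul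
          (ih n (by omega) (by omega) hmn)).weaken ?_
        have : (0 : ℝ) ≤ n := n.cast_nonneg
        simp only [hη, coeffOrder]
        push_cast
        linarith
      · refine (PowerLike.zero η).congr (Eventually.of_forall fun q => ?_)
        rw [show P.prevPoly q (n + 1) = P.coeffPoly q n from rfl,
          Polynomial.coeff_eq_zero_of_natDegree_lt
            ((P.natDegree_coeffPoly_le q n).trans_lt (by omega)), mul_zero]
  have hconst : PowerLike (fun q => P.midConst q (n + 1) * (P.coeffPoly q n).coeff m) η
      (if m = n + 1 then 0 else P.t₁ * (P.t₂⁻¹ ^ n * P.t₁⁻¹ ^ m)) := by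
    split_ifs with hmn
    · refine (PowerLike.zero η).congr (Eventually.of_forall fun q => ?_)
      rw [Polynomial.coeff_eq_zero_of_natDegree_lt
        ((P.natDegree_coeffPoly_le q n).trans_lt (by omega)), mul_zero]
    · refine ((hP.midConst n).mul (ih n (by omega) (by omega) (by omega))).congr_exp ?_ rfl
      simp only [hη, coeffOrder]
      push_cast
      ring
  have hX : PowerLike (fun q => q ^ (((n + 1 : ℕ) : ℝ) - 1 + P.lam) *
      (Polynomial.X * P.coeffPoly q n).coeff m) η
      (if m = n + 1 then P.t₂⁻¹ ^ n * P.t₁⁻¹ ^ n else 0) := by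
    cases m with
    | zero => simpa using PowerLike.zero η
    | succ m =>
      simp only [Polynomial.coeff_X_mul]
      have h1 := (PowerLike.rpow (((n + 1 : ℕ) : ℝ) - 1 + P.lam)).mul
        (ih n (by omega) (by omega) (by omega : m ≤ n))
      split_ifs with hmn
      · obtain rfl : m = n := by omega
        refine h1.congr_exp ?_ (one_mul _)
        simp only [hη, coeffOrder]
        push_cast
        ring
      · refine h1.weaken ?_
        have : (m : ℝ) + 1 ≤ n := by exact_mod_cast (by omega : m + 1 ≤ n)
        simp only [hη, coeffOrder]
        push_cast
        nlinarith
  have hall := ((hP.recLead n).inv (mul_ne_zero ht₁ ht₂)).mul ((hX.add hconst).sub hprev)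
  refine (hall.congr (Eventually.of_forall fun q => ?_)).congr_exp (by rw [hη]; ring) ?_
  · rw [coeffPoly_succ, recMid_eq, Polynomial.coeff_C_mul, Polynomial.coeff_sub,
      Polynomial.coeff_C_mul, add_mul, Polynomial.coeff_add, mul_assoc, Polynomial.coeff_C_mul,
      Polynomial.coeff_C_mul]
  · split_ifs with hmn
    · subst hmn
      rw [pow_succ, pow_succ]
      field_simp
      ring
    · rw [pow_succ]
      field_simp
      ring

end Admissible

end QHeunParams

/-! ### Roots of the spectral polynomial -/

/-- A real polynomial of degree `N + 1` with roots `f 0 > f 1 > ⋯ > f N` has no other roots. -/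
lemma Polynomial.sort_roots_eq_of_antitone {p : Polynomial ℝ} {N : ℕ} {f : ℕ → ℝ} (hp : p ≠ 0)
    (hdeg : p.natDegree = N + 1) (hroot : ∀ i ≤ N, p.IsRoot (f i))
    (hf : ∀ i < N, f (i + 1) < f i) :
    p.roots.toFinset.card = N + 1 ∧
      p.roots.sort (· ≤ ·) = (List.range (N + 1)).map fun j => f (N - j) := by
  have hanti : ∀ i j, i < j → j ≤ N → f j < f i := by
    intro i j hij
    induction j, hij using Nat.le_induction with
    | base => exact fun h => hf i (by omega)
    | succ j hj ih => exact fun h => (hf j (by omega)).trans (ih (by omega))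
  set l := (List.range (N + 1)).map fun j => f (N - j) with hl
  have hlt : l.Pairwise (· < ·) := by
    rw [hl, List.pairwise_map]
    refine List.pairwise_lt_range.imp_of_mem fun {a b} ha hb hab => ?_
    rw [List.mem_range] at ha hb
    exact hanti _ _ (by omega) (by omega)
  have hnodup : (l : Multiset ℝ).Nodup := Multiset.coe_nodup.2 (hlt.imp fun h => h.ne)
  have hcard : (l : Multiset ℝ).card = N + 1 := by simp [hl]
  have hroots : (l : Multiset ℝ) = p.roots := by
    refine Multiset.eq_of_le_of_card_le ((Multiset.le_iff_subset hnodup).2 fun y hy => ?_) ?_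
    · rw [Multiset.mem_coe, hl, List.mem_map] at hy
      obtain ⟨j, -, rfl⟩ := hy
      exact (Polynomial.mem_roots hp).2 (hroot _ (by omega))
    · rw [hcard, ← hdeg]
      exact p.card_roots'
  rw [← hroots]
  refine ⟨by rw [Multiset.toFinset_card_of_nodup hnodup, hcard], ?_⟩
  rw [Multiset.coe_sort]
  exact List.mergeSort_eq_self (· ≤ ·) (hlt.imp fun h => h.le)

namespace QHeunParams

variable {P : QHeunParams} {N : ℕ}

namespace Admissible

lemma continuousAt_coeff (hP : P.Admissible N) (n m : ℕ) :
    ∀ᶠ q in 𝓝[>] 0, ContinuousAt (fun q => (P.coeffPoly q n).coeff m) q := by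
  induction n using Nat.strong_induction_on generalizing m with
  | _ n ih =>
  cases n with
  | zero => exact Eventually.of_forall fun q => by simpa [coeffPoly] using continuousAt_const
  | succ n =>
  have hprev : ∀ᶠ q in 𝓝[>] 0, ContinuousAt (fun q => (P.prevPoly q n).coeff m) q := by
    cases n with
    | zero => exact Eventually.of_forall fun q => by simpa [prevPoly] using continuousAt_const
    | succ n => exact ih n (by omega) m
  have hX : ∀ᶠ q in 𝓝[>] 0,
      ContinuousAt (fun q => (Polynomial.X * P.coeffPoly q n).coeff m) q := by
    cases m with
    | zero => exact Eventually.of_forall fun q => by simpa using continuousAt_const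
    | succ m => simpa only [Polynomial.coeff_X_mul] using ih n (by omega) m
  filter_upwards [hprev, hX, ih n (by omega) m, eventually_mem_Ioo_nhdsGT_zero,
    (hP.recLead n).eventually_ne_zero (mul_ne_zero hP.t₁_pos.ne' hP.t₂_pos.ne')]
    with q h1 h2 h3 hq hlead
  have hq0 : q ≠ 0 := hq.1.ne'
  have hL : ContinuousAt (fun q => P.recLead q (n + 1)) q := by
    unfold QHeunParams.recLead
    fun_prop (disch := exact Or.inl hq0)
  have hM : ContinuousAt (fun q => P.midConst q (n + 1)) q := by
    unfold QHeunParams.midConst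
    fun_prop (disch := exact Or.inl hq0)
  have hT : ContinuousAt (fun q => P.recTail q (n + 1)) q := by
    unfold QHeunParams.recTail
    fun_prop (disch := exact Or.inl hq0)
  have hE : ContinuousAt (fun q : ℝ => q ^ (((n + 1 : ℕ) : ℝ) - 1 + P.lam)) q :=
    Real.continuousAt_rpow_const _ _ (Or.inl hq0)
  refine ((hL.inv₀ hlead).mul (((hE.mul h2).add (hM.mul h3)).sub (hT.mul h1))).congr
    (Eventually.of_forall fun q => ?_)
  simp only [Pi.mul_apply, Pi.inv_apply, Pi.add_apply, Pi.sub_apply]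
  rw [coeffPoly_succ, recMid_eq, Polynomial.coeff_C_mul, Polynomial.coeff_sub,
    Polynomial.coeff_C_mul, add_mul, Polynomial.coeff_add, mul_assoc, Polynomial.coeff_C_mul,
    Polynomial.coeff_C_mul]

lemma continuousAt_eval (hP : P.Admissible N) (n : ℕ) {E : ℝ → ℝ}
    (hE : ∀ᶠ q in 𝓝[>] 0, ContinuousAt E q) :
    ∀ᶠ q in 𝓝[>] 0, ContinuousAt (fun q => (P.coeffPoly q n).eval (E q)) q := by
  have h : ∀ᶠ q in 𝓝[>] 0, ∀ m ∈ Finset.range (n + 1),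
      ContinuousAt (fun q => (P.coeffPoly q n).coeff m) q :=
    (Finset.eventually_all _).2 fun m _ => hP.continuousAt_coeff n m
  filter_upwards [h, hE] with q h1 h2
  have h3 : (fun q => (P.coeffPoly q n).eval (E q)) =
      fun q => ∑ m ∈ Finset.range (n + 1), (P.coeffPoly q n).coeff m * E q ^ m := funext fun q =>
    Polynomial.eval_eq_sum_range' (Nat.lt_succ_of_le (P.natDegree_coeffPoly_le q n)) _
  rw [h3]
  exact tendsto_finsetSum _ fun m hm => (h1 m hm).mul (h2.pow m)

/-- The coefficient ratios of `c_{N+1}` have orders `m + λ₁ - 1/2 - h₁`, so there are `N + 1`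
branches. Their sizes separate them, and they exhaust the degree. A larger `i` gives a more negative
root, so `E i` is the `(N + 1 - i)`-th smallest. -/
lemma exists_spectralRoots (hP : P.Admissible N) :
    ∃ E : ℕ → ℝ → ℝ,
      (∀ i ≤ N, (∀ᶠ q in 𝓝[>] 0, ContinuousAt (E i) q) ∧
        PowerLike (E i) (-(i + P.lam - 1 / 2 - P.h₁)) (-P.t₁)) ∧
      ∀ᶠ q in 𝓝[>] 0, (P.coeffPoly q (N + 1)).natDegree = N + 1 ∧
        (P.coeffPoly q (N + 1)).roots.toFinset.card = N + 1 ∧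
        ∀ i ≤ N, (P.coeffPoly q (N + 1)).IsRoot (E i q) ∧
          P.spectralRoot N (N + 1 - i) q = E i q := by
  have ht₁ := hP.t₁_pos.ne'
  have ht₂ := hP.t₂_pos.ne'
  have hC : ∀ n m, P.t₂⁻¹ ^ n * P.t₁⁻¹ ^ m ≠ 0 := fun n m => by positivity
  have hex : ∀ i, i ≤ N → ∃ x : ℝ → ℝ, (∀ᶠ q in 𝓝[>] 0, ContinuousAt x q) ∧
      (∀ᶠ q in 𝓝[>] 0, (P.coeffPoly q (N + 1)).IsRoot (x q)) ∧
      PowerLike x (-(i + P.lam - 1 / 2 - P.h₁)) (-P.t₁) := by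
    intro i hi
    obtain ⟨x, h1, h2, h3⟩ := exists_root_branch (N := N + 1) (n := i) (by omega)
      (fun m q => (P.coeffPoly q (N + 1)).coeff m) (fun m => m + P.lam - 1 / 2 - P.h₁)
      (fun _ => P.t₁⁻¹) (fun m _ => hP.continuousAt_coeff _ m) (fun _ _ => inv_ne_zero ht₁)
      (fun m _ => by push_cast; linarith)
      (fun m hm => ((hP.coeff le_rfl (m := m + 1) (by omega)).div
        (hP.coeff le_rfl (m := m) (by omega)) (hC _ _)).congr_exp
          (by simp only [coeffOrder]; push_cast; ring)
          (by rw [pow_succ P.t₁⁻¹ m, ← mul_assoc, mul_div_cancel_left₀ _ (hC _ _)]))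
    refine ⟨x, h1, ?_, h3.congr_exp rfl (by rw [inv_inv])⟩
    filter_upwards [h2] with q hq
    rwa [Polynomial.IsRoot.def, Polynomial.eval_eq_sum_range'
      (Nat.lt_succ_of_le (P.natDegree_coeffPoly_le q (N + 1)))]
  choose! E hEc hEr hE using hex
  refine ⟨E, fun i hi => ⟨hEc i hi, hE i hi⟩, ?_⟩
  have hroot : ∀ᶠ q in 𝓝[>] 0, ∀ i ∈ Finset.range (N + 1),
      (P.coeffPoly q (N + 1)).IsRoot (E i q) :=
    (Finset.eventually_all _).2 fun i hi => hEr i (by simpa [Nat.lt_succ_iff] using hi)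
  have hlt : ∀ᶠ q in 𝓝[>] 0, ∀ i ∈ Finset.range N, E (i + 1) q < E i q := by
    refine (Finset.eventually_all _).2 fun i hi => ?_
    rw [Finset.mem_range] at hi
    exact (hE (i + 1) (by omega)).eventually_lt
      ((hE i (by omega)).weaken (by push_cast; linarith)) (neg_lt_zero.2 hP.t₁_pos)
  filter_upwards [hroot, hlt,
    (hP.coeff le_rfl (le_refl (N + 1))).eventually_ne_zero (hC _ _)] with q h1 h2 h3
  have hdeg : (P.coeffPoly q (N + 1)).natDegree = N + 1 :=
    le_antisymm (P.natDegree_coeffPoly_le q _) (Polynomial.le_natDegree_of_ne_zero h3)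
  have h1' : ∀ i ≤ N, (P.coeffPoly q (N + 1)).IsRoot (E i q) :=
    fun i hi => h1 i (by simpa [Nat.lt_succ_iff] using hi)
  obtain ⟨h4, h5⟩ := Polynomial.sort_roots_eq_of_antitone (f := fun i => E i q)
    (fun h => h3 (by simp [h])) hdeg h1' fun i hi => h2 i (by simpa using hi)
  refine ⟨hdeg, h4, fun i hi => ⟨h1' i hi, ?_⟩⟩
  -- The list position is `N - i`, within range, so the default value is not used.
  rw [spectralRoot, h5, List.getD_eq_getElem _ _ (by simp)]
  simp only [List.getElem_map, List.getElem_range]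
  congr 1
  omega

/-! ### Ratios `c_{n+1}(E) / c_n(E)` at a spectral root, and zeros of the Heun polynomial -/

/-- The values `c_n(E)` satisfy the three term relation, with the factor of `c_{n-1}` written
out. -/
lemma recLead_mul_eval (hP : P.Admissible N) (n : ℕ) (E : ℝ → ℝ) :
    ∀ᶠ q in 𝓝[>] 0, P.recLead q (n + 1) * (P.coeffPoly q (n + 1)).eval (E q) =
      (q ^ ((n : ℝ) + P.lam) * E q + P.midConst q (n + 1)) * (P.coeffPoly q n).eval (E q)
        - P.recTail q (n + 1) * (P.prevPoly q n).eval (E q) := by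
  filter_upwards [(hP.recLead n).eventually_ne_zero
    (mul_ne_zero hP.t₁_pos.ne' hP.t₂_pos.ne')] with q hq
  rw [coeffPoly_succ, recMid_eq]
  simp only [Polynomial.eval_mul, Polynomial.eval_add, Polynomial.eval_sub, Polynomial.eval_C,
    Polynomial.eval_X]
  rw [mul_inv_cancel_left₀ hq]
  push_cast
  rw [add_sub_cancel_right]

variable {i : ℕ} {E : ℝ → ℝ}

lemma mid_of_lt (hP : P.Admissible N) (hE : PowerLike E (-(i + P.lam - 1 / 2 - P.h₁)) (-P.t₁))
    {n : ℕ} (hn : n < i) :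
    PowerLike (fun q => q ^ ((n : ℝ) + P.lam) * E q + P.midConst q (n + 1))
      (n - i + 1 / 2 + P.h₁) (-P.t₁) := by
  have : (n : ℝ) < i := by exact_mod_cast hn
  exact ((((PowerLike.rpow _).mul hE).congr_exp (by ring) (one_mul _)).add
    ((hP.midConst n).weaken (by linarith))).congr_exp rfl (add_zero _)

lemma mid_of_gt (hP : P.Admissible N) (hE : PowerLike E (-(i + P.lam - 1 / 2 - P.h₁)) (-P.t₁))
    {n : ℕ} (hn : i < n) :
    PowerLike (fun q => q ^ ((n : ℝ) + P.lam) * E q + P.midConst q (n + 1))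
      (1 / 2 + P.h₁) P.t₁ := by
  have : (i : ℝ) < n := by exact_mod_cast hn
  exact ((((PowerLike.rpow _).mul hE).weaken (by linarith)).add
    (hP.midConst n)).congr_exp rfl (zero_add _)

/-- Below the index of the chosen spectral root the ratios are found by forward recursion. -/
lemma ratio_of_lt (hP : P.Admissible N) (hi : i ≤ N)
    (hE : PowerLike E (-(i + P.lam - 1 / 2 - P.h₁)) (-P.t₁)) {n : ℕ} (hn : n < i) :
    PowerLike (fun q => (P.coeffPoly q (n + 1)).eval (E q) / (P.coeffPoly q n).eval (E q))
      (1 / 2 - P.h₂ + n - i) (-P.t₂⁻¹) := by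
  have ht₁ := hP.t₁_pos.ne'
  have ht₂ := hP.t₂_pos.ne'
  have hgap := hP.gap_pos
  induction n with
  | zero =>
    have h1 := (hP.mid_of_lt hE hn).mul ((hP.recLead 0).inv (mul_ne_zero ht₁ ht₂))
    refine (h1.congr ?_).congr_exp (by ring) (by field_simp)
    filter_upwards [hP.recLead_mul_eval 0 E,
      (hP.recLead 0).eventually_ne_zero (mul_ne_zero ht₁ ht₂)] with q hq hL
    simp only [prevPoly, coeffPoly, Polynomial.eval_zero, Polynomial.eval_one, mul_zero,
      sub_zero, mul_one, div_one, zero_add] at hq hL ⊢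
    rw [← hq]
    field_simp
  | succ n ih =>
    have ih := ih (by omega)
    have hni : (n : ℝ) + 1 < i := by exact_mod_cast hn
    have hn0 : (0 : ℝ) ≤ n := n.cast_nonneg
    -- Dividing the recurrence by `c_{n+1}` leaves this correction, of higher order than the middle
    -- factor by `gap_pos`.
    have h1 := (hP.recTail (n := n + 1) (by omega)).div ih (by simp [ht₂])
    have h2 := ((hP.mid_of_lt hE hn).sub (h1.weaken
      (by push_cast; linarith))).mul ((hP.recLead (n + 1)).inv (mul_ne_zero ht₁ ht₂))
    refine (h2.congr ?_).congr_exp (by push_cast; ring) (by field_simp; ring)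
    filter_upwards [hP.recLead_mul_eval (n + 1) E, ih.eventually_ne_zero (by simp [ht₂]),
      (hP.recLead (n + 1)).eventually_ne_zero (mul_ne_zero ht₁ ht₂)] with q hq hr hL
    obtain ⟨h3, h4⟩ := div_ne_zero_iff.1 hr
    simp only [prevPoly] at hq
    rw [eq_div_iff h3, ← div_eq_mul_inv, div_mul_eq_mul_div, div_eq_iff hL,
      mul_comm _ (P.recLead _ _), hq]
    field_simp

/-- Above the index of the chosen spectral root the ratios are found by backward recursion,
starting from `c_{N+1}(E) = 0`. -/
lemma exists_ratio_of_ge (hP : P.Admissible N)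
    (hE : PowerLike E (-(i + P.lam - 1 / 2 - P.h₁)) (-P.t₁))
    (hroot : ∀ᶠ q in 𝓝[>] 0, (P.coeffPoly q (N + 1)).IsRoot (E q)) {n : ℕ} (hin : i ≤ n)
    (hnN : n < N) :
    ∃ ρ : ℝ → ℝ, (∀ᶠ q in 𝓝[>] 0, (P.coeffPoly q (n + 1)).eval (E q) =
        ρ q * (P.coeffPoly q n).eval (E q)) ∧
      PowerLike ρ (2 * n + 5 / 2 + P.h₂ - P.l₁ - P.l₂ - P.β) P.t₁⁻¹ := by
  have ht₁ := hP.t₁_pos.ne'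
  have ht₂ := hP.t₂_pos.ne'
  have hgap := hP.gap_pos
  have hn0 : (0 : ℝ) ≤ n := n.cast_nonneg
  -- Order `o(q ^ (1/2 - h₂))` makes `recLead * ρ'` negligible against the middle factor; at `n + 1
  -- = N` the ratio is `0`. Using `ρ` instead of a quotient avoids assuming `c_n(E) ≠ 0`, which is
  -- proved only afterwards.
  have hnext : ∃ ρ : ℝ → ℝ, (∀ᶠ q in 𝓝[>] 0, (P.coeffPoly q (n + 1 + 1)).eval (E q) =
        ρ q * (P.coeffPoly q (n + 1)).eval (E q)) ∧ PowerLike ρ (1 / 2 - P.h₂) 0 := by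
    rcases (Nat.succ_le_of_lt hnN).lt_or_eq with h | h
    · obtain ⟨ρ, h1, h2⟩ := exists_ratio_of_ge hP hE hroot (n := n + 1) (by omega) h
      exact ⟨ρ, h1, h2.weaken (by push_cast; linarith)⟩
    · refine ⟨fun _ => 0, ?_, PowerLike.zero _⟩
      filter_upwards [hroot] with q hq
      rw [show n + 1 + 1 = N + 1 by omega, hq.eq_zero, zero_mul]
  obtain ⟨ρ', h1, h2⟩ := hnext
  have h3 : PowerLike (fun q => q ^ (((n + 1 : ℕ) : ℝ) + P.lam) * E q + P.midConst q (n + 1 + 1)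
      - P.recLead q (n + 1 + 1) * ρ' q) (1 / 2 + P.h₁) P.t₁ :=
    ((hP.mid_of_gt hE (n := n + 1) (by omega)).sub (((hP.recLead (n + 1)).mul h2).congr_exp
      (e' := 1 / 2 + P.h₁) (by ring) rfl)).congr_exp rfl (by ring)
  -- The recurrence solved for `c_{n+1}`: `ρ = recTail / (mid - recLead * ρ')`.
  refine ⟨_, ?_, ((hP.recTail (n := n + 1) (by omega)).div h3 ht₁).congr_exp
    (by push_cast; ring) (one_div _)⟩
  filter_upwards [h1, hP.recLead_mul_eval (n + 1) E, h3.eventually_ne_zero ht₁] with q h4 h5 h6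
  simp only [prevPoly] at h5
  rw [h4] at h5
  rw [div_mul_eq_mul_div, eq_div_iff h6]
  linarith
termination_by N - n

lemma eval_ne_zero (hP : P.Admissible N) (hi : i ≤ N)
    (hE : PowerLike E (-(i + P.lam - 1 / 2 - P.h₁)) (-P.t₁))
    (hroot : ∀ᶠ q in 𝓝[>] 0, (P.coeffPoly q (N + 1)).IsRoot (E q)) {n : ℕ} (hn : n ≤ N) :
    ∀ᶠ q in 𝓝[>] 0, (P.coeffPoly q n).eval (E q) ≠ 0 := by
  induction n with
  | zero => exact Eventually.of_forall fun q => by simp [coeffPoly]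
  | succ n ih =>
    rcases lt_or_ge n i with h | h
    · filter_upwards [(hP.ratio_of_lt hi hE h).eventually_ne_zero (by simp [hP.t₂_pos.ne'])]
        with q hq
      exact (div_ne_zero_iff.1 hq).1
    · obtain ⟨ρ, h1, h2⟩ := hP.exists_ratio_of_ge hE hroot h hn
      filter_upwards [h1, h2.eventually_ne_zero (inv_ne_zero hP.t₁_pos.ne'), ih (by omega)]
        with q h3 h4 h5
      rw [h3]
      exact mul_ne_zero h4 h5

lemma ratio_of_ge (hP : P.Admissible N) (hi : i ≤ N)
    (hE : PowerLike E (-(i + P.lam - 1 / 2 - P.h₁)) (-P.t₁))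
    (hroot : ∀ᶠ q in 𝓝[>] 0, (P.coeffPoly q (N + 1)).IsRoot (E q)) {n : ℕ} (hin : i ≤ n)
    (hnN : n < N) :
    PowerLike (fun q => (P.coeffPoly q (n + 1)).eval (E q) / (P.coeffPoly q n).eval (E q))
      (2 * n + 5 / 2 + P.h₂ - P.l₁ - P.l₂ - P.β) P.t₁⁻¹ := by
  obtain ⟨ρ, h1, h2⟩ := hP.exists_ratio_of_ge hE hroot hin hnN
  refine h2.congr ?_
  filter_upwards [h1, hP.eval_ne_zero hi hE hroot hnN.le] with q h3 h4
  rw [h3, mul_div_cancel_right₀ _ h4]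

/-- The zeros of the Heun polynomial, indexed by the ratio of coefficients they come from. -/
lemma exists_heunPoly_roots (hP : P.Admissible N) (hi : i ≤ N)
    (hEc : ∀ᶠ q in 𝓝[>] 0, ContinuousAt E q)
    (hE : PowerLike E (-(i + P.lam - 1 / 2 - P.h₁)) (-P.t₁))
    (hroot : ∀ᶠ q in 𝓝[>] 0, (P.coeffPoly q (N + 1)).IsRoot (E q)) {n : ℕ} (hn : n < N) :
    ∃ x : ℝ → ℝ, (∀ᶠ q in 𝓝[>] 0, ContinuousAt x q) ∧
      (∀ᶠ q in 𝓝[>] 0, (P.heunPoly N q (E q)).IsRoot (x q)) ∧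
      (n < i → PowerLike x (i - n - 1 / 2 + P.h₂) P.t₂) ∧
      (i ≤ n → PowerLike x (-2 * n - 5 / 2 - P.h₂ + P.l₁ + P.l₂ + P.β) (-P.t₁)) := by
  have ht₁ := hP.t₁_pos.ne'
  have ht₂ := hP.t₂_pos.ne'
  have hgap := hP.gap_pos
  obtain ⟨x, h1, h2, h3⟩ := exists_root_branch hn
    (fun m q => (P.coeffPoly q m).eval (E q))
    (fun m => if m < i then 1 / 2 - P.h₂ + m - i
      else 2 * m + 5 / 2 + P.h₂ - P.l₁ - P.l₂ - P.β)
    (fun m => if m < i then -P.t₂⁻¹ else P.t₁⁻¹)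
    (fun m _ => hP.continuousAt_eval m hEc)
    (fun m _ => by split_ifs <;> simp [ht₁, ht₂])
    (fun m _ => by
      have hm0 : (0 : ℝ) ≤ m := m.cast_nonneg
      split_ifs with h h' h'
      · push_cast; linarith
      -- The jump from the forward to the backward regime, at `m + 1 = i`, is positive by `gap_pos`.
      · have : (m : ℝ) < i := by exact_mod_cast h
        push_cast; linarith
      · omega
      · push_cast; linarith)
    (fun m hm => by
      split_ifs with h
      · exact hP.ratio_of_lt hi hE h
      · exact hP.ratio_of_ge hi hE hroot (by omega) hm)
  refine ⟨x, h1, ?_, fun h => ?_, fun h => ?_⟩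
  · filter_upwards [h2] with q hq
    rw [Polynomial.IsRoot.def, heunPoly, Polynomial.eval_finsetSum]
    simpa using hq
  · simp only [if_pos h] at h3
    exact h3.congr_exp (by ring) (by rw [inv_neg, inv_inv, neg_neg])
  · simp only [if_neg (not_lt.2 h)] at h3
    exact h3.congr_exp (by ring) (by rw [inv_inv])

end Admissible

end QHeunParams

/-! ### Assembly and reindexing -/

theorem theorem5p2 (P : QHeunParams) (N k : ℕ)
    (hN : (N : ℝ) = -P.lam - P.α₁) (hβ : P.β < 1) (hα : P.α₂ - P.α₁ < 1)
    (ht₁ : 0 < P.t₁) (ht₂ : 0 < P.t₂) (hh : P.h₁ < P.h₂) (hl : P.l₁ < P.l₂)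
    (h1 : 0 < 1 + P.h₂ - P.l₂ - P.β) (h2 : 0 < 2 + 2 * P.h₂ - P.l₁ - P.l₂ - P.β)
    (hk1 : 1 ≤ k) (hkN : k ≤ N + 1) :
    ∃ q₀ : ℝ, 0 < q₀ ∧ q₀ < 1 ∧
      (∀ q ∈ Ioo 0 q₀, (P.coeffPoly q (N + 1)).natDegree = N + 1 ∧
        (P.coeffPoly q (N + 1)).roots.toFinset.card = N + 1) ∧
      ∃ x : ℕ → ℝ → ℝ,
        (∀ j ∈ Finset.Icc 1 N, ContinuousOn (x j) (Ioo 0 q₀) ∧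
          ∀ q ∈ Ioo 0 q₀, (P.heunPoly N q (P.spectralRoot N (N + 2 - k) q)).IsRoot (x j q)) ∧
        (∀ j ∈ Finset.Icc 1 N, j < k →
          Tendsto (fun q : ℝ => x j q / (q ^ ((j : ℝ) - 1 / 2 + P.h₂) * P.t₂))
            (𝓝[>] 0) (𝓝 1)) ∧
        (∀ j ∈ Finset.Icc 1 N, k ≤ j →
          Tendsto (fun q : ℝ => x j q /
              (-(q ^ (-2 * (j : ℝ) - 1 / 2 - P.h₂ + P.l₁ + P.l₂ + P.β) * P.t₁)))
            (𝓝[>] 0) (𝓝 1)) := by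
  have hP : P.Admissible N := ⟨hN, hβ, hα, ht₁, ht₂, hh, hl, h1, h2⟩
  obtain ⟨E, hE, hEq⟩ := hP.exists_spectralRoots
  obtain ⟨i, rfl⟩ : ∃ i, k = i + 1 := ⟨k - 1, by omega⟩
  have hi : i ≤ N := by omega
  have hroot : ∀ᶠ q in 𝓝[>] 0, (P.coeffPoly q (N + 1)).IsRoot (E i q) :=
    hEq.mono fun q hq => (hq.2.2 i hi).1
  have hex : ∀ n, n < N → _ := fun n hn =>
    hP.exists_heunPoly_roots hi (hE i hi).1 (hE i hi).2 hroot hn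
  choose! y hyc hyr hy₁ hy₂ using hex
  have hall : ∀ᶠ q in 𝓝[>] 0, ∀ n ∈ Finset.range N,
      ContinuousAt (y n) q ∧ (P.heunPoly N q (E i q)).IsRoot (y n q) :=
    (Finset.eventually_all _).2 fun n hn =>
      (hyc n (Finset.mem_range.1 hn)).and (hyr n (Finset.mem_range.1 hn))
  obtain ⟨q₀, hq₀, hsub⟩ := mem_nhdsGT_iff_exists_Ioo_subset.1 (hall.and hEq)
  have hsub' : ∀ q ∈ Ioo 0 (min q₀ (1 / 2)), q ∈ Ioo 0 q₀ := fun q hq =>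
    ⟨hq.1, hq.2.trans_le (min_le_left _ _)⟩
  have key : ∀ f : ℝ → ℝ, ∀ e e' C : ℝ, PowerLike f e C → e = e' → C ≠ 0 →
      Tendsto (fun q => f q / (q ^ e' * C)) (𝓝[>] 0) (𝓝 1) := by
    rintro f e _ C hf rfl hC
    have h := (hf.div ((PowerLike.rpow e).mul (PowerLike.const C)) (by simpa using hC)).congr_exp
      (e' := 0) (C' := 1) (by ring) (by rw [one_mul, div_self hC])
    exact h.tendsto
  refine ⟨min q₀ (1 / 2), lt_min hq₀ (by norm_num), (min_le_right _ _).trans_lt (by norm_num),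
    -- For `n < i` the zero `y n` has order `i - n - 1/2 + h₂`, so `n = i - j` reverses the forward
    -- branches; the others are shifted by one. Each `n < N` occurs exactly once for `1 ≤ j ≤ N`.
    fun q hq => ?_, fun j => if j < i + 1 then y (i - j) else y (j - 1),
    fun j hj => ⟨?_, ?_⟩, ?_, ?_⟩
  · have := (hsub (hsub' q hq)).2
    exact ⟨this.1, this.2.1⟩
  · rw [Finset.mem_Icc] at hj
    intro q hq
    have := (hsub (hsub' q hq)).1
    refine ContinuousAt.continuousWithinAt ?_
    dsimp only
    split_ifs with hjk
    · exact (this _ (Finset.mem_range.2 (by omega))).1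
    · exact (this _ (Finset.mem_range.2 (by omega))).1
  · rw [Finset.mem_Icc] at hj
    intro q hq
    have hq' := hsub (hsub' q hq)
    have hE' := (hq'.2.2.2 i hi).2
    rw [show N + 2 - (i + 1) = N + 1 - i by omega, hE']
    dsimp only
    split_ifs with hjk
    · exact (hq'.1 _ (Finset.mem_range.2 (by omega))).2
    · exact (hq'.1 _ (Finset.mem_range.2 (by omega))).2
  · intro j hj hjk
    rw [Finset.mem_Icc] at hj
    simp only [if_pos hjk]
    refine key _ _ _ _ (hy₁ (i - j) (by omega) (by omega)) ?_ ht₂.ne'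
    rw [Nat.cast_sub (by omega)]
    ring
  · intro j hj hjk
    rw [Finset.mem_Icc] at hj
    simp only [if_neg (not_lt.2 hjk)]
    have := key _ _ (-2 * (j : ℝ) - 1 / 2 - P.h₂ + P.l₁ + P.l₂ + P.β) _
      (hy₂ (j - 1) (by omega) (by omega))
      (by rw [Nat.cast_sub (by omega)]; push_cast; ring) (neg_ne_zero.2 ht₁.ne')
    simpa only [mul_neg] using this
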